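/- Let $d\ge 0$ be an integer, let $\mathbb{R}^d$ carry the Euclidean metric, and let $\Delta=\{(u,v)\in\mathbb{R}^2: v\le u\}$. For a non-empty set $X\subset\mathbb{R}^d$, let $B(x,R)$ denote the closed ball of radius $R$ centred at $x$ in the metric space $X$, and for $E\subset X$ and $r>0$ let $P_r(E)$ denote the maximal cardinality of a subset of $E$ whose distinct points are at distance strictly larger than $4r$. The infimal two-scale branching function of $X$ is $$\underline{\beta}_X(u,v)=\log_2\inf_{x\in X}P_{2^{-u}}\bigl(B(x,2^{-v})\bigr),\qquad (u,v)\in\Delta.$$ Let $\mathcal{L}(d)$ denote the set of functions $f\colon\Delta\to[0,\infty)$ such that $f(u,u)=0$ for all $u$, $f(u,v)\ge f(u,w)+f(w,v)$ for all $v\le w\le u$, and for each $v\in\mathbb{R}$ the function $u\mapsto f(u,v)$ is $d$-Lipschitz on $[v,\infty)$. For $f,g\colon\Delta\to[0,\infty)$, write $f\sim_d g$ if there is a constant $z\ge 0$ depending only on $d$ such that for all $0\le v\le u$, $$f(u,v+z)-z\le g(u,v)\ \text{ whenever } v\le u-z,\qquad\text{and}\qquad g(u,v)\le f(u,v-z)+z\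 \text{ whenever } v\ge z.$$ Then the following hold. (i) For every non-empty set $X\subset\mathbb{R}^d$, the function $\underline{\beta}_X$ takes values in $[0,\infty)$ and there is a function $f\in\mathcal{L}(d)$ such that $f\sim_d\underline{\beta}_X$. (ii) For every $f\in\mathcal{L}(d)$ there is a non-empty compact set $X\subset\mathbb{R}^d$ such that $f\sim_d\underline{\beta}_X$. In both parts the constant $z$ depends only on $d$, and not on $X$ or $f$. -/

import Mathlib

open scoped NNReal ENNReal

noncomputable section

/-- `P_r(E)`: the maximal cardinality of a subset of `E` whose distinct points are at distance
strictly larger than `4 r`. -/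
def strongPacking {Y : Type*} [MetricSpace Y] (r : ℝ≥0) (E : Set Y) : ℕ∞ :=
  Metric.packingNumber (4 * r) E

/-- The logarithm in base `2` on `[0, ∞]`, with values `-∞` at `0` and `∞` at `∞`. -/
def extLogTwo (t : ℝ≥0∞) : EReal :=
  ENNReal.log t / ((Real.log 2 : ℝ) : EReal)

/-- The infimal two-scale branching function of a subset `X` of a metric space, with the metric
induced on `X` (so that balls are intersected with `X`):
`(u, v) ↦ log₂ inf_{x ∈ X} P_{2^{-u}}(B(x, 2^{-v}))`, `B` a closed ball. It is meant for `v ≤ u`.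
The infimum over the empty set is `∞`. -/
def lowerBranching {Y : Type*} [MetricSpace Y] (X : Set Y) (u v : ℝ) : EReal :=
  extLogTwo
    ((⨅ x ∈ X, strongPacking ((2 : ℝ≥0) ^ (-u)) (X ∩ Metric.closedBall x ((2 : ℝ) ^ (-v))) : ℕ∞) :
      ℝ≥0∞)

/-- The class `𝓛(α)` of functions `f : Δ → [0, ∞)`, where `Δ = {(u, v) : v ≤ u}`. A function on `Δ`
is represented by `f : ℝ → ℝ → ℝ`, of which only the values `f u v` with `v ≤ u` matter. -/
structure MemL (α : ℝ≥0) (f : ℝ → ℝ → ℝ) : Prop where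
  nonneg : ∀ u v : ℝ, v ≤ u → 0 ≤ f u v
  diag : ∀ u : ℝ, f u u = 0
  superadd : ∀ u w v : ℝ, v ≤ w → w ≤ u → f u w + f w v ≤ f u v
  lipschitz : ∀ v : ℝ, LipschitzOnWith α (fun u => f u v) (Set.Ici v)

/-- `f ∼ g` with constant `z`, for functions `f, g : Δ → [0, ∞)`. The functions are given with
extended real values, and it is part of the relation that on `Δ` they take values in `[0, ∞)`. -/
structure SimWith (z : ℝ) (f g : ℝ → ℝ → EReal) : Prop where
  left_range : ∀ u v : ℝ, v ≤ u → 0 ≤ f u v ∧ f u v < ⊤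
  right_range : ∀ u v : ℝ, v ≤ u → 0 ≤ g u v ∧ g u v < ⊤
  lower : ∀ u v : ℝ, 0 ≤ v → v ≤ u → v ≤ u - z → f u (v + z) - (z : EReal) ≤ g u v
  upper : ∀ u v : ℝ, 0 ≤ v → v ≤ u → z ≤ v → g u v ≤ f u (v - z) + (z : EReal)

end

/-!
For (i), counting points with separation `2 * 2 ^ (-u)` in balls of radius `2 ^ (-v) - 2 ^ (-u)`
instead gives a function which is exactly superadditive: a separated subset of a smaller ball can be
placed around each point of a coarser separated set, and the radii add up without loss. Up to a
shift of `v` and an additive constant it agrees with the branching function, and so does the largest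
Lipschitz function below it, which is still superadditive.

For (ii), let `X` consist of `0` and, for each `n`, a piece of size at most `2 ^ (-n)` near the
point `3 * 2 ^ (-n) * (1, …, 1)`. The points of the `n`-th piece have free binary digits in
prescribed positions, about `f k n` of them before the position `k`. Small balls around a corner of
the `n`-th piece see only that piece, which bounds the branching function of `X` from above. From
below, every ball of radius about `2 ^ (-m)` contains all points that share the first `m` digits
with some point of an `n`-th piece with `n ≤ m`; there are about `f k n - f m n ≥ f k m` free digits
left.
-/

open Metric Set

section Logarithm

/-- The logarithm in base `2` of an extended natural number, as a real number. The junk values at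
`0` and `∞` are both `0`. -/
noncomputable def logTwo (n : ℕ∞) : ℝ :=
  Real.logb 2 n.toNat

theorem logTwo_nonneg (n : ℕ∞) : 0 ≤ logTwo n := by
  rw [logTwo, Real.logb]
  positivity

@[simp]
theorem logTwo_one : logTwo 1 = 0 := by
  simp [logTwo]

@[simp]
theorem logTwo_two_pow (n : ℕ) : logTwo (2 ^ n : ℕ) = n := by
  rw [logTwo, ENat.toNat_natCast, Nat.cast_pow, Nat.cast_ofNat, Real.logb_pow,
    Real.logb_self_eq_one one_lt_two, mul_one]

theorem logTwo_le_logTwo {m n : ℕ∞} (hmn : m ≤ n) (hn : n ≠ ⊤) : logTwo m ≤ logTwo n := by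
  rcases eq_or_ne m 0 with rfl | hm
  · simpa [logTwo] using logTwo_nonneg n
  · have hm' : 0 < m.toNat := ENat.toNat_pos hm (ne_top_of_le_ne_top hn hmn)
    exact Real.logb_le_logb_of_le one_lt_two (by exact_mod_cast hm')
      (by exact_mod_cast ENat.toNat_le_toNat hmn hn)

theorem logTwo_natCast_mul {m n : ℕ} (hm : m ≠ 0) (hn : n ≠ 0) :
    logTwo (m * n : ℕ) = logTwo m + logTwo n := by
  simpa [logTwo] using Real.logb_mul (Nat.cast_ne_zero.2 hm) (Nat.cast_ne_zero.2 hn)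

theorem logTwo_floor_rpow_le {s : ℝ} (hs : 0 ≤ s) : logTwo ⌊(2 : ℝ) ^ s⌋₊ ≤ s := by
  have hpos : 0 < ⌊(2 : ℝ) ^ s⌋₊ := Nat.floor_pos.2 (Real.one_le_rpow one_le_two hs)
  rw [logTwo, ENat.toNat_natCast,
    Real.logb_le_iff_le_rpow one_lt_two (by exact_mod_cast hpos)]
  exact Nat.floor_le (by positivity)

theorem extLogTwo_toENNReal {n : ℕ∞} (h0 : n ≠ 0) (htop : n ≠ ⊤) :
    extLogTwo n = (logTwo n : EReal) := by
  lift n to ℕ using htop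
  rw [extLogTwo, logTwo, Real.logb, ENat.toENNReal_coe,
    ENNReal.log_pos_real (by exact_mod_cast h0) (by simp), ENNReal.toReal_natCast,
    ENat.toNat_natCast, EReal.coe_div]

end Logarithm

section PackingNumber

variable {Y : Type*} [MetricSpace Y] {A : Set Y} {r s : ℝ≥0} {n : ℕ}

theorem isSeparated_iff_pairwise_lt_dist :
    IsSeparated (r : ℝ≥0∞) A ↔ A.Pairwise fun x y => (r : ℝ) < dist x y := by
  simp only [IsSeparated, edist_nndist, ENNReal.coe_lt_coe, ← NNReal.coe_lt_coe, coe_nndist]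

theorem natCast_le_packingNumber_iff :
    (n : ℕ∞) ≤ packingNumber r A ↔
      ∃ C : Finset Y, ↑C ⊆ A ∧ (C : Set Y).Pairwise (fun x y => (r : ℝ) < dist x y) ∧
        C.card = n := by
  simp only [← isSeparated_iff_pairwise_lt_dist]
  constructor
  · intro h
    obtain ⟨C, hCA, hC, hn⟩ : ∃ C ⊆ A, IsSeparated (r : ℝ≥0∞) C ∧ (n : ℕ∞) ≤ C.encard := by
      rcases eq_or_ne (packingNumber r A) ⊤ with htop | htop
      · have hlt : (n : ℕ∞) < packingNumber r A := htop ▸ ENat.natCast_lt_top n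
        simp only [packingNumber, lt_iSup_iff] at hlt
        obtain ⟨C, hCA, hC, hn⟩ := hlt
        exact ⟨C, hCA, hC, hn.le⟩
      · obtain ⟨C, hCA, -, hC, hn⟩ := exists_set_encard_eq_packingNumber htop
        exact ⟨C, hCA, hC, hn ▸ h⟩
    obtain ⟨D, hDC, hD⟩ := exists_subset_encard_eq hn
    lift D to Finset Y using finite_of_encard_eq_coe hD
    exact ⟨D, hDC.trans hCA, hC.subset hDC, by simpa using hD⟩
  · rintro ⟨C, hCA, hC, rfl⟩
    simpa using hC.encard_le_packingNumber hCA

theorem packingNumber_le_natCast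
    (h : ∀ C : Finset Y, ↑C ⊆ A → (C : Set Y).Pairwise (fun x y => (r : ℝ) < dist x y) →
      C.card ≤ n) : packingNumber r A ≤ n := by
  by_contra! hlt
  obtain ⟨C, hCA, hC, hn⟩ := (natCast_le_packingNumber_iff (n := n + 1)).1
    (Order.add_one_le_of_lt hlt)
  exact absurd (h C hCA hC) (by omega)

theorem packingNumber_mono {A B : Set Y} (hrs : s ≤ r) (hAB : A ⊆ B) :
    packingNumber r A ≤ packingNumber s B :=
  iSup₂_le fun _ hC => iSup_le fun hsep =>
    (hsep.anti (ENNReal.coe_le_coe.2 hrs)).encard_le_packingNumber (hC.trans hAB)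

theorem packingNumber_le_coveringNumber_mul {K : ℕ∞}
    (hK : ∀ x ∈ A, packingNumber s (A ∩ closedBall x r) ≤ K) :
    packingNumber s A ≤ coveringNumber r A * K := by
  rcases A.eq_empty_or_nonempty with rfl | ⟨a, ha⟩
  · simp
  rcases eq_or_ne (coveringNumber r A) ⊤ with htop | htop
  · have ha' : a ∈ A ∩ closedBall a r := ⟨ha, mem_closedBall_self r.coe_nonneg⟩
    have hK0 : K ≠ 0 := ((packingNumber_pos_iff.2 ⟨a, ha'⟩).trans_le (hK a ha)).ne'
    rw [htop, ENat.top_mul hK0]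
    exact le_top
  obtain ⟨N, hNA, hN, hcov, hcard⟩ := exists_set_encard_eq_coveringNumber htop
  lift N to Finset Y using hN
  rw [← hcard, encard_coe_eq_coe_finsetCard, ← nsmul_eq_mul]
  refine iSup₂_le fun C hCA => iSup_le fun hC => ?_
  have hsub : C ⊆ ⋃ y ∈ N, C ∩ closedBall y r := by
    rw [← inter_iUnion₂]
    exact subset_inter subset_rfl (hCA.trans (isCover_iff_subset_iUnion_closedBall.1 hcov))
  calc C.encard ≤ (⋃ y ∈ N, C ∩ closedBall y r).encard := encard_le_encard hsub
    _ ≤ ∑ y ∈ N, (C ∩ closedBall y r).encard := N.set_encard_biUnion_le _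
    _ ≤ N.card • K := Finset.sum_le_card_nsmul _ _ _ fun y hy =>
      ((hC.subset inter_subset_left).encard_le_packingNumber
        (inter_subset_inter_left _ hCA)).trans (hK y (hNA hy))

end PackingNumber

section InfPacking

/-- The least `r`-packing number of a closed ball of radius `R` in the subspace `X`; the two-scale
branching function is its logarithm along `r = 4 * 2 ^ (-u)` and `R = 2 ^ (-v)`. -/
noncomputable def infPacking {Y : Type*} [MetricSpace Y] (X : Set Y) (r : ℝ≥0) (R : ℝ) : ℕ∞ :=
  ⨅ x ∈ X, packingNumber r (X ∩ closedBall x R)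

variable {Y : Type*} [MetricSpace Y] {X : Set Y} {r s : ℝ≥0} {R S : ℝ}

theorem infPacking_mono (hrs : s ≤ r) (hRS : R ≤ S) : infPacking X r R ≤ infPacking X s S :=
  iInf₂_mono fun _ _ =>
    packingNumber_mono hrs (inter_subset_inter_right X (closedBall_subset_closedBall hRS))

theorem one_le_infPacking (hR : 0 ≤ R) : 1 ≤ infPacking X r R :=
  le_iInf₂ fun x hx => Order.one_le_iff_pos.2 <|
    packingNumber_pos_iff.2 ⟨x, hx, mem_closedBall_self hR⟩

theorem exists_infPacking_eq (hX : X.Nonempty) (r : ℝ≥0) (R : ℝ) :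
    ∃ x ∈ X, infPacking X r R = packingNumber r (X ∩ closedBall x R) := by
  have hmem := csInf_mem (hX.image fun x => packingNumber r (X ∩ closedBall x R))
  rw [sInf_image] at hmem
  obtain ⟨x, hx, h⟩ := hmem
  exact ⟨x, hx, h.symm⟩

theorem infPacking_eq_one (hX : X.Nonempty) (hR : 0 ≤ R) (hRr : 2 * R ≤ r) :
    infPacking X r R = 1 := by
  refine le_antisymm ?_ (one_le_infPacking hR)
  obtain ⟨x, hx⟩ := hX
  refine (iInf₂_le x hx).trans (packingNumber_le_natCast (n := 1) fun C hC hsep => ?_)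
  refine Finset.card_le_one.2 fun a ha b hb => by_contra fun hab => ?_
  have hlt := hsep ha hb hab
  have htri := dist_triangle_right a b x
  have hax := mem_closedBall.1 (hC ha).2
  have hbx := mem_closedBall.1 (hC hb).2
  linarith

theorem infPacking_le_mul (hX : X.Nonempty) {K : ℕ∞}
    (hK : ∀ x ∈ X, packingNumber s (X ∩ closedBall x r) ≤ K) :
    infPacking X s R ≤ infPacking X r R * K := by
  obtain ⟨x, hx, heq⟩ := exists_infPacking_eq hX r R
  calc infPacking X s R ≤ packingNumber s (X ∩ closedBall x R) := iInf₂_le x hx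
    _ ≤ coveringNumber r (X ∩ closedBall x R) * K :=
      packingNumber_le_coveringNumber_mul fun y hy => (packingNumber_mono le_rfl
        (inter_subset_inter_left _ inter_subset_left)).trans (hK y hy.1)
    _ ≤ infPacking X r R * K := by
      rw [heq]
      gcongr
      exact coveringNumber_le_packingNumber _ _

/-- Placing an `s`-separated subset of `closedBall c S` around each point `c` of an `r`-separated
subset of `closedBall x R` gives an `s`-separated subset of `closedBall x (R + S)`. -/
theorem natCast_mul_le_infPacking (hrs : s + 2 * S ≤ r) {m n : ℕ}
    (hm : m ≤ infPacking X r R) (hn : n ≤ infPacking X s S) :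
    (m * n : ℕ) ≤ infPacking X s (R + S) := by
  classical
  refine le_iInf₂ fun x hx => ?_
  obtain ⟨C, hCX, hC, rfl⟩ := natCast_le_packingNumber_iff.1 (hm.trans (iInf₂_le x hx))
  have hblock : ∀ c ∈ X, ∃ D : Finset Y, ↑D ⊆ X ∩ closedBall c S ∧
      (D : Set Y).Pairwise (fun y z => (s : ℝ) < dist y z) ∧ D.card = n := fun c hc =>
    natCast_le_packingNumber_iff.1 (hn.trans (iInf₂_le c hc))
  choose! D hDX hD hcard using hblock
  have hsep : ∀ c ∈ C, ∀ e ∈ C, c ≠ e → ∀ y ∈ D c, ∀ z ∈ D e, (s : ℝ) < dist y z := by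
    intro c hc e he hce y hy z hz
    have hlt := hC hc he hce
    have hyc := mem_closedBall'.1 (hDX c (hCX hc).1 hy).2
    have hze := mem_closedBall.1 (hDX e (hCX he).1 hz).2
    have htri := dist_triangle4 c y z e
    linarith
  refine natCast_le_packingNumber_iff.2 ⟨C.biUnion D, fun y hy => ?_, fun y hy z hz hyz => ?_, ?_⟩
  · obtain ⟨c, hc, hyc⟩ := Finset.mem_biUnion.1 hy
    have hmem := hDX c (hCX hc).1 hyc
    refine ⟨hmem.1, mem_closedBall.2 ?_⟩
    have hycS := mem_closedBall.1 hmem.2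
    have hcxR := mem_closedBall.1 (hCX hc).2
    linarith [dist_triangle y c x]
  · obtain ⟨c, hc, hyc⟩ := Finset.mem_biUnion.1 hy
    obtain ⟨e, he, hze⟩ := Finset.mem_biUnion.1 hz
    rcases eq_or_ne c e with rfl | hce
    · exact hD c (hCX hc).1 hyc hze hyz
    · exact hsep c hc e he hce y hyc z hze
  · rw [Finset.card_biUnion, Finset.sum_const_nat fun c hc => hcard c (hCX hc).1]
    refine fun c hc e he hce => Finset.disjoint_left.2 fun y hy hy' => ?_
    have hlt := hsep c hc e he hce y hy y hy'
    rw [dist_self] at hlt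
    exact absurd hlt (not_lt.2 s.coe_nonneg)

end InfPacking

section PackingGrowth

/-- Every ball of radius `R` in `X` has `r`-packing number at most `2 ^ κ * (R / r) ^ α`, for all
`r ≤ R`: this is the quantitative form of the bound `dim_A X ≤ α` on the Assouad dimension. -/
def PackingGrowth {Y : Type*} [MetricSpace Y] (X : Set Y) (α κ : ℝ≥0) : Prop :=
  ∀ x ∈ X, ∀ r R : ℝ≥0, 0 < r → r ≤ R →
    packingNumber r (X ∩ closedBall x R) ≤ (⌊(2 : ℝ) ^ (κ : ℝ) * (R / r : ℝ) ^ (α : ℝ)⌋₊ : ℕ)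

variable {Y : Type*} [MetricSpace Y] {X : Set Y} {α κ : ℝ≥0}

theorem PackingGrowth.infPacking_ne_top (h : PackingGrowth X α κ) (hX : X.Nonempty) {r : ℝ≥0}
    (hr : 0 < r) (R : ℝ) : infPacking X r R ≠ ⊤ := by
  obtain ⟨x, hx⟩ := hX
  refine ne_top_of_le_ne_top (ENat.natCast_ne_top _) <| (iInf₂_le x hx).trans <|
    (packingNumber_mono le_rfl (inter_subset_inter_right X (closedBall_subset_closedBall ?_))).trans
      (h x hx r (max r R.toNNReal) hr (le_max_left _ _))
  exact (Real.le_coe_toNNReal R).trans (NNReal.coe_le_coe.2 (le_max_right _ _))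

theorem PackingGrowth.exists_natCast_eq_infPacking (h : PackingGrowth X α κ) (hX : X.Nonempty)
    {r : ℝ≥0} (hr : 0 < r) {R : ℝ} (hR : 0 ≤ R) :
    ∃ n : ℕ, n ≠ 0 ∧ (n : ℕ∞) = infPacking X r R := by
  obtain ⟨n, hn⟩ := ENat.ne_top_iff_exists.1 (h.infPacking_ne_top hX hr R)
  have hone : (1 : ℕ∞) ≤ n := hn ▸ one_le_infPacking hR
  exact ⟨n, Nat.one_le_iff_ne_zero.1 (by exact_mod_cast hone), hn⟩

end PackingGrowth

section Branching

variable {Y : Type*} [MetricSpace Y] {X : Set Y} {α κ : ℝ≥0} {u v w : ℝ}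

/-- The infimal two-scale branching function as a real-valued function. -/
noncomputable def branching (X : Set Y) (u v : ℝ) : ℝ :=
  logTwo (infPacking X (4 * 2 ^ (-u)) (2 ^ (-v)))

/-- A variant of `branching` which is superadditive without any error: with separation
`2 * 2 ^ (-u)` and radius `2 ^ (-v) - 2 ^ (-u)`, the scales of two consecutive steps match exactly
in `natCast_mul_le_infPacking`. -/
noncomputable def exactBranching (X : Set Y) (u v : ℝ) : ℝ :=
  logTwo (infPacking X (2 * 2 ^ (-u)) (2 ^ (-v) - 2 ^ (-u)))

theorem branching_nonneg : 0 ≤ branching X u v :=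
  logTwo_nonneg _

theorem exactBranching_nonneg : 0 ≤ exactBranching X u v :=
  logTwo_nonneg _

theorem two_rpow_neg_le (huv : v ≤ u) : (2 : ℝ) ^ (-u) ≤ 2 ^ (-v) :=
  Real.rpow_le_rpow_of_exponent_le one_le_two (neg_le_neg huv)

theorem two_mul_two_rpow_neg (v : ℝ) : 2 * (2 : ℝ) ^ (-v) = 2 ^ (-(v - 1)) := by
  rw [neg_sub, sub_eq_add_neg, Real.rpow_add two_pos, Real.rpow_one]

theorem branching_eq_zero (hX : X.Nonempty) (huv : u ≤ v) : branching X u v = 0 := by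
  have hvu := two_rpow_neg_le huv
  have hpos : (0 : ℝ) < 2 ^ (-u) := by positivity
  rw [branching, infPacking_eq_one hX (by positivity) (by push_cast; linarith), logTwo_one]

theorem exactBranching_self (hX : X.Nonempty) : exactBranching X u u = 0 := by
  rw [exactBranching, sub_self, infPacking_eq_one hX le_rfl
    ((mul_zero _).trans_le (NNReal.coe_nonneg _)), logTwo_one]

namespace PackingGrowth

theorem lowerBranching_eq (h : PackingGrowth X α κ) (hX : X.Nonempty) (u v : ℝ) :
    lowerBranching X u v = (branching X u v : EReal) :=
  extLogTwo_toENNReal (one_pos.trans_le (one_le_infPacking (by positivity))).ne'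
    (h.infPacking_ne_top hX (by positivity) _)

theorem branching_anti (h : PackingGrowth X α κ) (hX : X.Nonempty) (hvw : v ≤ w) :
    branching X u w ≤ branching X u v :=
  logTwo_le_logTwo (infPacking_mono le_rfl (two_rpow_neg_le hvw))
    (h.infPacking_ne_top hX (by positivity) _)

theorem branching_le_add (h : PackingGrowth X α κ) (hX : X.Nonempty) (hwu : w ≤ u) :
    branching X u v ≤ branching X w v + (α * (u - w) + κ) := by
  have hexp : 0 ≤ α * (u - w) + κ := by
    have := sub_nonneg.2 hwu
    positivity
  have hlocal : ∀ x ∈ X, packingNumber (4 * 2 ^ (-u)) (X ∩ closedBall x (4 * 2 ^ (-w) : ℝ≥0)) ≤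
      (⌊(2 : ℝ) ^ (α * (u - w) + κ)⌋₊ : ℕ) := by
    intro x hx
    have hscale : (2 : ℝ) ^ (κ : ℝ) * ((4 * 2 ^ (-w) : ℝ≥0) / (4 * 2 ^ (-u) : ℝ≥0) : ℝ) ^ (α : ℝ) =
        2 ^ (α * (u - w) + κ) := by
      push_cast
      rw [mul_div_mul_left _ _ (by norm_num), ← Real.rpow_sub two_pos, ← Real.rpow_mul two_pos.le,
        ← Real.rpow_add two_pos]
      ring_nf
    refine hscale ▸ h x hx _ _ (by positivity) ?_
    gcongr
    exact one_le_two
  obtain ⟨N, hN0, hN⟩ := h.exists_natCast_eq_infPacking hX (r := 4 * 2 ^ (-w)) (by positivity)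
    (R := 2 ^ (-v)) (by positivity)
  have hfloor0 : ⌊(2 : ℝ) ^ (α * (u - w) + κ)⌋₊ ≠ 0 :=
    (Nat.floor_pos.2 (Real.one_le_rpow one_le_two hexp)).ne'
  calc branching X u v
      ≤ logTwo (N * ⌊(2 : ℝ) ^ (α * (u - w) + κ)⌋₊ : ℕ) := by
        refine logTwo_le_logTwo ?_ (ENat.natCast_ne_top _)
        rw [Nat.cast_mul, hN]
        exact infPacking_le_mul hX hlocal
    _ = branching X w v + logTwo ⌊(2 : ℝ) ^ (α * (u - w) + κ)⌋₊ := by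
        rw [logTwo_natCast_mul hN0 hfloor0, hN, branching]
    _ ≤ branching X w v + (α * (u - w) + κ) := by
        gcongr
        exact logTwo_floor_rpow_le hexp

theorem exactBranching_superadd (h : PackingGrowth X α κ) (hX : X.Nonempty) (hvw : v ≤ w)
    (hwu : w ≤ u) : exactBranching X u w + exactBranching X w v ≤ exactBranching X u v := by
  have hcount : ∀ {u v : ℝ}, v ≤ u →
      ∃ n : ℕ, n ≠ 0 ∧ (n : ℕ∞) = infPacking X (2 * 2 ^ (-u)) (2 ^ (-v) - 2 ^ (-u)) := fun hvu =>
    h.exists_natCast_eq_infPacking hX (by positivity) (sub_nonneg.2 (two_rpow_neg_le hvu))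
  obtain ⟨m, hm0, hm⟩ := hcount hvw
  obtain ⟨n, hn0, hn⟩ := hcount hwu
  have hmul := natCast_mul_le_infPacking (by push_cast; linarith) hm.le hn.le
  rw [sub_add_sub_cancel] at hmul
  calc exactBranching X u w + exactBranching X w v = logTwo (m * n : ℕ) := by
        rw [logTwo_natCast_mul hm0 hn0, hm, hn, exactBranching, exactBranching, add_comm]
    _ ≤ exactBranching X u v := logTwo_le_logTwo hmul
        (h.infPacking_ne_top hX (by positivity) _)

theorem exactBranching_le_branching (h : PackingGrowth X α κ) (hX : X.Nonempty) :
    exactBranching X u v ≤ branching X u v + (α + κ) := by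
  calc exactBranching X u v ≤ branching X (u + 1) v := by
        refine logTwo_le_logTwo (infPacking_mono ?_ (sub_le_self _ (by positivity)))
          (h.infPacking_ne_top hX (by positivity) _)
        rw [← NNReal.coe_le_coe]
        push_cast
        have := two_mul_two_rpow_neg (u + 1)
        rw [add_sub_cancel_right] at this
        linarith
    _ ≤ branching X u v + (α + κ) := by
        simpa using h.branching_le_add hX (le_add_of_nonneg_right zero_le_one)

theorem branching_le_exactBranching (h : PackingGrowth X α κ) (hX : X.Nonempty) :
    branching X u v ≤ exactBranching X u (v - 1) := by
  rcases le_total u v with huv | hvu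
  · rw [branching_eq_zero hX huv]
    exact exactBranching_nonneg
  · refine logTwo_le_logTwo (infPacking_mono ?_ ?_) (h.infPacking_ne_top hX (by positivity) _)
    · gcongr
      norm_num
    · rw [← two_mul_two_rpow_neg]
      linarith [two_rpow_neg_le hvu]

end PackingGrowth

end Branching

section LipschitzMinorant

/-- The largest minorant of `f` which is `α`-Lipschitz in the first variable, for `f` increasing in
that variable. -/
noncomputable def lipschitzMinorant (α : ℝ≥0) (f : ℝ → ℝ → ℝ) (u v : ℝ) : ℝ :=
  ⨅ w : Icc v u, f w v + α * (u - w)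

variable {α : ℝ≥0} {f : ℝ → ℝ → ℝ} {u v w : ℝ}

theorem lipschitzMinorant_le (hf : ∀ u v, v ≤ u → 0 ≤ f u v) (hvw : v ≤ w) (hwu : w ≤ u) :
    lipschitzMinorant α f u v ≤ f w v + α * (u - w) := by
  refine ciInf_le (f := fun w : Icc v u => f w v + α * (u - w)) ⟨0, ?_⟩ ⟨w, hvw, hwu⟩
  rintro _ ⟨t, rfl⟩
  exact add_nonneg (hf _ _ t.2.1) (mul_nonneg α.coe_nonneg (sub_nonneg.2 t.2.2))

theorem lipschitzMinorant_le_self (hf : ∀ u v, v ≤ u → 0 ≤ f u v) (hvu : v ≤ u) :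
    lipschitzMinorant α f u v ≤ f u v := by
  simpa using lipschitzMinorant_le (α := α) hf hvu le_rfl

theorem le_lipschitzMinorant {c : ℝ} (hvu : v ≤ u)
    (h : ∀ w, v ≤ w → w ≤ u → c ≤ f w v + α * (u - w)) : c ≤ lipschitzMinorant α f u v :=
  have : Nonempty (Icc v u) := ⟨⟨v, le_rfl, hvu⟩⟩
  le_ciInf fun t => h t t.2.1 t.2.2

theorem lipschitzMinorant_nonneg (hf : ∀ u v, v ≤ u → 0 ≤ f u v) (hvu : v ≤ u) :
    0 ≤ lipschitzMinorant α f u v :=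
  le_lipschitzMinorant hvu fun w hvw hwu =>
    add_nonneg (hf w v hvw) (mul_nonneg α.coe_nonneg (sub_nonneg.2 hwu))

theorem lipschitzMinorant_superadd (hf : ∀ u v, v ≤ u → 0 ≤ f u v) (hdiag : ∀ u, f u u = 0)
    (hsup : ∀ u w v, v ≤ w → w ≤ u → f u w + f w v ≤ f u v) (hvw : v ≤ w) (hwu : w ≤ u) :
    lipschitzMinorant α f u w + lipschitzMinorant α f w v ≤ lipschitzMinorant α f u v := by
  refine le_lipschitzMinorant (hvw.trans hwu) fun t hvt htu => ?_
  rcases le_total w t with hwt | htw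
  · linarith [lipschitzMinorant_le (α := α) hf hwt htu, hsup t w v hvw hwt,
      lipschitzMinorant_le_self (α := α) hf hvw]
  · have huw := lipschitzMinorant_le (α := α) hf le_rfl hwu
    rw [hdiag] at huw
    linarith [lipschitzMinorant_le (α := α) hf hvt htw]

theorem lipschitzMinorant_mono (hf : ∀ u v, v ≤ u → 0 ≤ f u v)
    (hmono : ∀ u w v, v ≤ w → w ≤ u → f w v ≤ f u v) (hvw : v ≤ w) (hwu : w ≤ u) :
    lipschitzMinorant α f w v ≤ lipschitzMinorant α f u v := by
  have hα : (0 : ℝ) ≤ α := α.coe_nonneg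
  refine le_lipschitzMinorant (hvw.trans hwu) fun t hvt htu => ?_
  rcases le_total t w with htw | hwt
  · calc lipschitzMinorant α f w v ≤ f t v + α * (w - t) := lipschitzMinorant_le hf hvt htw
      _ ≤ f t v + α * (u - t) := by gcongr
  · calc lipschitzMinorant α f w v ≤ f w v := lipschitzMinorant_le_self hf hvw
      _ ≤ f t v := hmono t w v hvw hwt
      _ ≤ f t v + α * (u - t) := le_add_of_nonneg_right (mul_nonneg hα (sub_nonneg.2 htu))

theorem lipschitzMinorant_le_add (hf : ∀ u v, v ≤ u → 0 ≤ f u v) (hvw : v ≤ w) (hwu : w ≤ u) :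
    lipschitzMinorant α f u v ≤ lipschitzMinorant α f w v + α * (u - w) := by
  rw [← sub_le_iff_le_add]
  refine le_lipschitzMinorant hvw fun t hvt htw => ?_
  linarith [lipschitzMinorant_le (α := α) hf hvt (htw.trans hwu)]

theorem memL_lipschitzMinorant (hf : ∀ u v, v ≤ u → 0 ≤ f u v) (hdiag : ∀ u, f u u = 0)
    (hsup : ∀ u w v, v ≤ w → w ≤ u → f u w + f w v ≤ f u v) :
    MemL α (lipschitzMinorant α f) where
  nonneg u v := lipschitzMinorant_nonneg hf
  diag u := le_antisymm ((lipschitzMinorant_le_self hf le_rfl).trans_eq (hdiag u))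
    (lipschitzMinorant_nonneg hf le_rfl)
  superadd u w v := lipschitzMinorant_superadd hf hdiag hsup
  lipschitz v := by
    have hmono : ∀ u w v, v ≤ w → w ≤ u → f w v ≤ f u v := fun u w v hvw hwu =>
      le_of_add_le_of_nonneg_right (hsup u w v hvw hwu) (hf u w hwu)
    refine LipschitzOnWith.of_le_add_mul α fun x hx y hy => ?_
    rcases le_total x y with hxy | hyx
    · exact (lipschitzMinorant_mono hf hmono hx hxy).trans
        (le_add_of_nonneg_right (by positivity))
    · rw [Real.dist_eq, abs_of_nonneg (sub_nonneg.2 hyx)]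
      exact lipschitzMinorant_le_add hf hy hyx

end LipschitzMinorant

section MemL

variable {α : ℝ≥0} {f : ℝ → ℝ → ℝ} {u v w : ℝ}

theorem MemL.mono (hf : MemL α f) (hvw : v ≤ w) (hwu : w ≤ u) : f w v ≤ f u v :=
  le_of_add_le_of_nonneg_right (hf.superadd u w v hvw hwu) (hf.nonneg u w hwu)

theorem MemL.anti (hf : MemL α f) (hvw : v ≤ w) (hwu : w ≤ u) : f u w ≤ f u v :=
  le_of_add_le_of_nonneg_left (hf.superadd u w v hvw hwu) (hf.nonneg w v hvw)

theorem MemL.le_add (hf : MemL α f) (hvw : v ≤ w) (hwu : w ≤ u) :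
    f u v ≤ f w v + α * (u - w) := by
  have hlip := (hf.lipschitz v).dist_le_mul u (hvw.trans hwu) w hvw
  rw [Real.dist_eq, Real.dist_eq, abs_of_nonneg (sub_nonneg.2 hwu)] at hlip
  linarith [le_abs_self (f u v - f w v)]

end MemL

section SimWith

variable {Y : Type*} [MetricSpace Y] {X : Set Y} {α κ : ℝ≥0} {z : ℝ} {f : ℝ → ℝ → ℝ}

namespace PackingGrowth

theorem simWith_lowerBranching (h : PackingGrowth X α κ) (hX : X.Nonempty)
    (hf : ∀ u v, v ≤ u → 0 ≤ f u v)
    (hlower : ∀ u v, 0 ≤ v → v + z ≤ u → f u (v + z) - z ≤ branching X u v)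
    (hupper : ∀ u v, z ≤ v → v ≤ u → branching X u v ≤ f u (v - z) + z) :
    SimWith z (fun u v => (f u v : EReal)) (lowerBranching X) where
  left_range u v hvu := ⟨EReal.coe_nonneg.2 (hf u v hvu), EReal.coe_lt_top _⟩
  right_range u v _ := by
    rw [h.lowerBranching_eq hX]
    exact ⟨EReal.coe_nonneg.2 branching_nonneg, EReal.coe_lt_top _⟩
  lower u v hv _ hvz := by
    rw [h.lowerBranching_eq hX, ← EReal.coe_sub, EReal.coe_le_coe_iff]
    exact hlower u v hv (le_sub_iff_add_le.1 hvz)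
  upper u v _ hvu hzv := by
    rw [h.lowerBranching_eq hX, ← EReal.coe_add, EReal.coe_le_coe_iff]
    exact hupper u v hzv hvu

theorem exists_memL_simWith (h : PackingGrowth X α κ) (hX : X.Nonempty) :
    ∃ f : ℝ → ℝ → ℝ, MemL α f ∧
      SimWith (α + κ + 1) (fun u v => (f u v : EReal)) (lowerBranching X) := by
  have hz : (1 : ℝ) ≤ α + κ + 1 := by linarith [α.coe_nonneg, κ.coe_nonneg]
  have hnonneg : ∀ u v, v ≤ u → 0 ≤ exactBranching X u v := fun _ _ _ => exactBranching_nonneg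
  have hmem : MemL α (lipschitzMinorant α (exactBranching X)) :=
    memL_lipschitzMinorant hnonneg (fun _ => exactBranching_self hX) fun _ _ _ =>
      h.exactBranching_superadd hX
  refine ⟨_, hmem, h.simWith_lowerBranching hX hmem.nonneg (fun u v _ hvu => ?_)
    fun u v _ hvu => ?_⟩
  · linarith [lipschitzMinorant_le_self (α := α) hnonneg hvu,
      h.exactBranching_le_branching hX (u := u) (v := v + (α + κ + 1)),
      h.branching_anti hX (u := u) (show v ≤ v + (α + κ + 1) by linarith [hz])]
  · have hminorant : branching X u v - κ ≤ lipschitzMinorant α (exactBranching X) u (v - 1) := by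
      refine le_lipschitzMinorant (by linarith) fun w _ hwu => ?_
      linarith [h.branching_le_add hX (v := v) hwu,
        h.branching_le_exactBranching hX (u := w) (v := v)]
    linarith [hmem.anti (show v - (α + κ + 1) ≤ v - 1 by linarith [hz])
      (show v - 1 ≤ u by linarith), α.coe_nonneg]

end PackingGrowth

end SimWith

section EuclideanGrowth

variable {E : Type*} [NormedAddCommGroup E] [NormedSpace ℝ E] [FiniteDimensional ℝ E]

open MeasureTheory Measure Module in
/-- The balls of radius `r / 2` around the points are disjoint and contained in the ball of radius
`R + r / 2`, so their total volume is at most the volume of the latter. -/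
theorem card_mul_pow_finrank_le {C : Finset E} {x : E} {r R : ℝ} (hr : 0 < r) (hR : 0 ≤ R)
    (hC : (C : Set E).Pairwise fun y z => r < dist y z) (hCR : ↑C ⊆ closedBall x R) :
    C.card * (r / 2) ^ finrank ℝ E ≤ (R + r / 2) ^ finrank ℝ E := by
  borelize E
  let μ : Measure E := addHaar
  have hvol : ∀ (c : E) {ρ : ℝ}, 0 < ρ →
      μ.real (ball c ρ) = ρ ^ finrank ℝ E * μ.real (ball 0 1) := fun c ρ hρ => by
    rw [Measure.real, addHaar_ball_of_pos μ c hρ, ENNReal.toReal_mul,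
      ENNReal.toReal_ofReal (by positivity), Measure.real]
  have hunit : 0 < μ.real (ball (0 : E) 1) :=
    ENNReal.toReal_pos (measure_ball_pos μ _ one_pos).ne' measure_ball_lt_top.ne
  have hdisj : (C : Set E).PairwiseDisjoint fun c => ball c (r / 2) := fun c hc e he hce =>
    ball_disjoint_ball (by linarith [hC hc he hce])
  have hsub : ⋃ c ∈ C, ball c (r / 2) ⊆ ball x (R + r / 2) :=
    iUnion₂_subset fun c hc => ball_subset_ball' (by linarith [mem_closedBall.1 (hCR hc)])
  refine le_of_mul_le_mul_right ?_ hunit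
  calc C.card * (r / 2) ^ finrank ℝ E * μ.real (ball 0 1)
      = ∑ c ∈ C, μ.real (ball c (r / 2)) := by
        simp only [hvol _ (half_pos hr), Finset.sum_const, nsmul_eq_mul, mul_assoc]
    _ = μ.real (⋃ c ∈ C, ball c (r / 2)) :=
        (measureReal_biUnion_finset hdisj (fun _ _ => measurableSet_ball)
          fun _ _ => measure_ball_lt_top.ne).symm
    _ ≤ μ.real (ball x (R + r / 2)) := measureReal_mono hsub measure_ball_lt_top.ne
    _ = (R + r / 2) ^ finrank ℝ E * μ.real (ball 0 1) := hvol x (by positivity)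

open Module in
theorem packingGrowth_of_finiteDimensional (X : Set E) :
    PackingGrowth X (finrank ℝ E) (2 * finrank ℝ E) := by
  intro x _ r R hr hrR
  have hr' : (0 : ℝ) < r := hr
  refine packingNumber_le_natCast fun C hC hsep => Nat.le_floor ?_
  have hvol := card_mul_pow_finrank_le hr' R.coe_nonneg hsep (hC.trans inter_subset_right)
  calc (C.card : ℝ) ≤ (R + r / 2) ^ finrank ℝ E / (r / 2) ^ finrank ℝ E :=
        (le_div_iff₀ (by positivity)).2 hvol
    _ = ((R + r / 2) / (r / 2)) ^ finrank ℝ E := (div_pow _ _ _).symm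
    _ ≤ (2 ^ 2 * (R / r)) ^ finrank ℝ E := by
        gcongr
        rw [← mul_div_assoc, div_le_div_iff₀ (by positivity) hr']
        nlinarith [NNReal.coe_le_coe.2 hrR]
    _ = 2 ^ ((2 * finrank ℝ E : ℝ≥0) : ℝ) * (R / r : ℝ) ^ ((finrank ℝ E : ℝ≥0) : ℝ) := by
        rw [mul_pow, ← pow_mul, ← Real.rpow_natCast, ← Real.rpow_natCast]
        push_cast
        rfl

end EuclideanGrowth

section BinaryExpansion

variable {x y : ℕ → Fin 2} {k : ℕ}

/-- The integer whose binary digits are the first `k` terms of `x`, most significant first; it is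
the integer part of `2 ^ k` times the number with binary expansion `x`. -/
def binaryPrefix (x : ℕ → Fin 2) : ℕ → ℕ
  | 0 => 0
  | k + 1 => 2 * binaryPrefix x k + x k

theorem two_pow_mul_ofDigits (x : ℕ → Fin 2) (k : ℕ) :
    2 ^ k * Real.ofDigits x = binaryPrefix x k + Real.ofDigits fun j => x (j + k) := by
  induction k with
  | zero => simp [binaryPrefix]
  | succ k ih =>
    have hstep : 2 * Real.ofDigits (fun j => x (j + k)) =
        (x k : ℕ) + Real.ofDigits fun j => x (j + (k + 1)) := by
      rw [Real.ofDigits_eq_sum_add_ofDigits (fun j => x (j + k)) 1]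
      simp only [Finset.sum_range_one, Real.ofDigitsTerm, zero_add, pow_one, Nat.cast_ofNat,
        add_right_comm _ 1 k, ← add_assoc]
      ring
    rw [pow_succ', mul_assoc, ih, mul_add, hstep, binaryPrefix]
    push_cast
    ring

theorem eq_of_binaryPrefix_eq (h : binaryPrefix x k = binaryPrefix y k) :
    ∀ j < k, x j = y j := by
  induction k with
  | zero => exact fun j hj => absurd hj j.not_lt_zero
  | succ k ih =>
    simp only [binaryPrefix] at h
    have hx := (x k).isLt
    have hy := (y k).isLt
    intro j hj
    rcases Nat.lt_succ_iff_lt_or_eq.1 hj with hj | rfl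
    · exact ih (by omega) j hj
    · exact Fin.ext (by omega)

/-- After multiplication by `2 ^ k` the two numbers differ by a nonzero integer. -/
theorem inv_two_pow_le_abs_ofDigits_sub (h : ∀ j, k ≤ j → x j = y j) (hne : x ≠ y) :
    ((2 : ℝ) ^ k)⁻¹ ≤ |Real.ofDigits x - Real.ofDigits y| := by
  have hprefix : (binaryPrefix x k : ℤ) ≠ binaryPrefix y k := fun heq => hne <| funext fun j =>
    (lt_or_ge j k).elim (eq_of_binaryPrefix_eq (by exact_mod_cast heq) j) (h j)
  have htail : (fun j => x (j + k)) = fun j => y (j + k) := funext fun j => h _ (by omega)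
  have hscaled : 2 ^ k * (Real.ofDigits x - Real.ofDigits y) =
      ((binaryPrefix x k - binaryPrefix y k : ℤ) : ℝ) := by
    rw [mul_sub, two_pow_mul_ofDigits, two_pow_mul_ofDigits, htail]
    push_cast
    ring
  have hone : (1 : ℝ) ≤ |((binaryPrefix x k - binaryPrefix y k : ℤ) : ℝ)| := by
    exact_mod_cast Int.one_le_abs (sub_ne_zero.2 hprefix)
  rw [← hscaled, abs_mul, abs_of_pos (by positivity)] at hone
  exact (inv_le_iff_one_le_mul₀' (by positivity)).2 hone

end BinaryExpansion

section DigitSet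

variable {ι : Type*}

/-- The point whose `i`-th coordinate exceeds that of `p` by the number with binary digits `ε i`. -/
noncomputable def binaryPoint (p : EuclideanSpace ℝ ι) (ε : ι → ℕ → Fin 2) : EuclideanSpace ℝ ι :=
  WithLp.toLp 2 fun i => p i + Real.ofDigits (ε i)

/-- The digit sequences whose `j`-th digit is free in the coordinates in `A j` and `0` in the
others. -/
def digitCodes (A : ℕ → Finset ι) : Set (ι → ℕ → Fin 2) :=
  {ε | ∀ i j, i ∉ A j → ε i j = 0}

/-- The subset of the unit cube with lower corner `p` prescribed by the free digits `A`. -/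
def digitSet (p : EuclideanSpace ℝ ι) (A : ℕ → Finset ι) : Set (EuclideanSpace ℝ ι) :=
  binaryPoint p '' digitCodes A

variable {p : EuclideanSpace ℝ ι} {A : ℕ → Finset ι} {ε η : ι → ℕ → Fin 2} {m k n : ℕ}

theorem binaryPoint_apply (i : ι) : binaryPoint p ε i = p i + Real.ofDigits (ε i) :=
  rfl

theorem continuous_binaryPoint (p : EuclideanSpace ℝ ι) : Continuous (binaryPoint p) :=
  (PiLp.continuous_toLp 2 _).comp <| continuous_pi fun i =>
    continuous_const.add (Real.continuous_ofDigits.comp (continuous_apply i))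

theorem isCompact_digitSet (p : EuclideanSpace ℝ ι) (A : ℕ → Finset ι) :
    IsCompact (digitSet p A) := by
  refine IsCompact.image (IsClosed.isCompact ?_) (continuous_binaryPoint p)
  simp only [digitCodes, ofPred_forall]
  refine isClosed_iInter fun i => isClosed_iInter fun j => isClosed_iInter fun _ => ?_
  exact isClosed_eq ((continuous_apply j).comp (continuous_apply i)) continuous_const

theorem binaryPoint_zero (p : EuclideanSpace ℝ ι) : binaryPoint p 0 = p := by
  ext i
  simp [binaryPoint_apply, Real.ofDigits, Real.ofDigitsTerm]

theorem self_mem_digitSet (p : EuclideanSpace ℝ ι) (A : ℕ → Finset ι) : p ∈ digitSet p A :=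
  ⟨0, fun _ _ _ => rfl, binaryPoint_zero p⟩

theorem apply_mem_Icc_of_mem_digitSet {x : EuclideanSpace ℝ ι} (hx : x ∈ digitSet p A)
    (hA : ∀ j < n, A j = ∅) (i : ι) : x i ∈ Icc (p i) (p i + ((2 : ℝ) ^ n)⁻¹) := by
  obtain ⟨ε, hε, rfl⟩ := hx
  have hdigits := Real.abs_ofDigits_sub_ofDigits_le (x := ε i) (y := 0) (n := n) fun j hj =>
    hε i j (by simp [hA j hj])
  have hzero : Real.ofDigits (0 : ℕ → Fin 2) = 0 := by
    simp [Real.ofDigits, Real.ofDigitsTerm]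
  rw [hzero, sub_zero] at hdigits
  rw [binaryPoint_apply]
  refine ⟨le_add_of_nonneg_right (Real.ofDigits_nonneg _), ?_⟩
  gcongr
  exact_mod_cast (le_abs_self _).trans hdigits

open Classical in
/-- Replaces the digits at the positions `j ∈ [m, k)` by the indicator of `S`. -/
noncomputable def overwriteBlock (m k : ℕ) (ε : ι → ℕ → Fin 2) (S : Finset (Σ _ : ℕ, ι)) :
    ι → ℕ → Fin 2 :=
  fun i j => if j ∈ Finset.Ico m k then if ⟨j, i⟩ ∈ S then 1 else 0 else ε i j

theorem overwriteBlock_of_notMem {S : Finset (Σ _ : ℕ, ι)} {j : ℕ} (hj : j ∉ Finset.Ico m k)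
    (i : ι) : overwriteBlock m k ε S i j = ε i j :=
  if_neg hj

theorem overwriteBlock_mem_digitCodes (hε : ε ∈ digitCodes A) {S : Finset (Σ _ : ℕ, ι)}
    (hS : S ⊆ (Finset.Ico m k).sigma A) : overwriteBlock m k ε S ∈ digitCodes A := by
  intro i j hij
  have hnotMem : (⟨j, i⟩ : Σ _ : ℕ, ι) ∉ S := fun h => hij (Finset.mem_sigma.1 (hS h)).2
  rw [overwriteBlock, if_neg hnotMem, hε i j hij, ite_self]

theorem overwriteBlock_injOn :
    InjOn (overwriteBlock m k ε) ((Finset.Ico m k).sigma A).powerset := by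
  intro S hS T hT h
  ext ⟨j, i⟩
  by_cases hj : j ∈ Finset.Ico m k
  · have hij := congrFun (congrFun h i) j
    simp only [overwriteBlock, if_pos hj] at hij
    split_ifs at hij <;> simp_all
  · have hnotMem : ∀ {U}, U ∈ ((Finset.Ico m k).sigma A).powerset → (⟨j, i⟩ : Σ _ : ℕ, ι) ∉ U :=
      fun hU h => hj (Finset.mem_sigma.1 (Finset.mem_powerset.1 hU h)).1
    exact iff_of_false (hnotMem hS) (hnotMem hT)

variable [Fintype ι]

theorem abs_sub_apply_le_dist (x y : EuclideanSpace ℝ ι) (i : ι) : |x i - y i| ≤ dist x y := by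
  rw [dist_eq_norm]
  exact PiLp.norm_apply_le (x - y) i

theorem dist_le_two_pow_mul {x y : EuclideanSpace ℝ ι} {s : ℝ} (hs : 0 ≤ s)
    (h : ∀ i, |x i - y i| ≤ s) : dist x y ≤ 2 ^ Fintype.card ι * s := by
  rw [EuclideanSpace.dist_eq, Real.sqrt_le_iff]
  refine ⟨by positivity, ?_⟩
  calc ∑ i, dist (x i) (y i) ^ 2 ≤ Fintype.card ι * s ^ 2 := by
        rw [← nsmul_eq_mul]
        refine Finset.sum_le_card_nsmul _ _ _ fun i _ => ?_
        exact pow_le_pow_left₀ dist_nonneg (h i) 2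
    _ ≤ (2 ^ Fintype.card ι) ^ 2 * s ^ 2 := by
        gcongr
        calc (Fintype.card ι : ℝ) ≤ 2 ^ Fintype.card ι := by
              exact_mod_cast Nat.lt_two_pow_self.le
          _ ≤ (2 ^ Fintype.card ι) ^ 2 := le_self_pow₀ (one_le_pow₀ one_le_two) two_ne_zero
    _ = (2 ^ Fintype.card ι * s) ^ 2 := (mul_pow _ _ _).symm

theorem dist_binaryPoint_le (h : ∀ i, ∀ j < n, ε i j = η i j) :
    dist (binaryPoint p ε) (binaryPoint p η) ≤ 2 ^ Fintype.card ι * ((2 : ℝ) ^ n)⁻¹ := by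
  refine dist_le_two_pow_mul (by positivity) fun i => ?_
  rw [binaryPoint_apply, binaryPoint_apply, add_sub_add_left_eq_sub]
  exact_mod_cast Real.abs_ofDigits_sub_ofDigits_le (h i)

theorem inv_two_pow_le_dist_binaryPoint (h : ∀ i, ∀ j, k ≤ j → ε i j = η i j) (hne : ε ≠ η) :
    ((2 : ℝ) ^ k)⁻¹ ≤ dist (binaryPoint p ε) (binaryPoint p η) := by
  obtain ⟨i, hi⟩ := Function.ne_iff.1 hne
  refine (inv_two_pow_le_abs_ofDigits_sub (h i) hi).trans ?_
  simpa only [binaryPoint_apply, add_sub_add_left_eq_sub] using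
    abs_sub_apply_le_dist (binaryPoint p ε) (binaryPoint p η) i

theorem two_pow_le_packingNumber_digitSet {x : EuclideanSpace ℝ ι} (hx : x ∈ digitSet p A)
    {r : ℝ≥0} {R : ℝ} (hr : r < ((2 : ℝ) ^ k)⁻¹)
    (hR : 2 ^ Fintype.card ι * ((2 : ℝ) ^ m)⁻¹ ≤ R) :
    (2 ^ ∑ j ∈ Finset.Ico m k, (A j).card : ℕ) ≤
      packingNumber r (digitSet p A ∩ closedBall x R) := by
  classical
  obtain ⟨ε, hε, rfl⟩ := hx
  have hsep : ∀ S T, overwriteBlock m k ε S ≠ overwriteBlock m k ε T → ((2 : ℝ) ^ k)⁻¹ ≤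
      dist (binaryPoint p (overwriteBlock m k ε S)) (binaryPoint p (overwriteBlock m k ε T)) :=
    fun S T => inv_two_pow_le_dist_binaryPoint fun i j hj => by
      have hj' : j ∉ Finset.Ico m k := fun h => (Finset.mem_Ico.1 h).2.not_ge hj
      rw [overwriteBlock_of_notMem hj', overwriteBlock_of_notMem hj']
  have hinj : InjOn (fun S => binaryPoint p (overwriteBlock m k ε S))
      ((Finset.Ico m k).sigma A).powerset := fun S hS T hT h =>
    overwriteBlock_injOn hS hT <| by_contra fun hne =>
      (hsep S T hne).not_gt (by rw [show binaryPoint p _ = _ from h, dist_self]; positivity)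
  refine natCast_le_packingNumber_iff.2
    ⟨((Finset.Ico m k).sigma A).powerset.image fun S => binaryPoint p (overwriteBlock m k ε S),
      fun y hy => ?_, fun y hy z hz hyz => ?_, ?_⟩
  · obtain ⟨S, hS, rfl⟩ := Finset.mem_image.1 hy
    refine ⟨⟨_, overwriteBlock_mem_digitCodes hε (Finset.mem_powerset.1 hS), rfl⟩,
      (dist_binaryPoint_le fun i j hj => overwriteBlock_of_notMem ?_ i).trans hR⟩
    exact fun h => (Finset.mem_Ico.1 h).1.not_gt hj
  · obtain ⟨S, -, rfl⟩ := Finset.mem_image.1 hy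
    obtain ⟨T, -, rfl⟩ := Finset.mem_image.1 hz
    exact hr.trans_le (hsep S T (ne_of_apply_ne _ hyz))
  · rw [Finset.card_image_of_injOn hinj, Finset.card_powerset, Finset.card_sigma]

/-- Points of a separated set are determined by the free digits before the position `k`. -/
theorem packingNumber_digitSet_le {r : ℝ≥0} (hr : 2 ^ Fintype.card ι * ((2 : ℝ) ^ k)⁻¹ ≤ r) :
    packingNumber r (digitSet p A) ≤ (2 ^ ∑ j ∈ Finset.range k, (A j).card : ℕ) := by
  classical
  refine packingNumber_le_natCast fun C hC hsep => ?_
  have hcode : ∀ c ∈ C, ∃ ε ∈ digitCodes A, binaryPoint p ε = c := fun c hc => hC hc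
  choose! code hmem hcode using hcode
  let ones : EuclideanSpace ℝ ι → Finset (Σ _ : ℕ, ι) := fun c =>
    {t ∈ (Finset.range k).sigma A | code c t.2 t.1 = 1}
  rw [← Finset.card_sigma, ← Finset.card_powerset]
  refine Finset.card_le_card_of_injOn ones
    (fun c _ => Finset.mem_powerset.2 (Finset.filter_subset _ _)) fun c hc e he hce => ?_
  by_contra hne
  refine (hsep hc he hne).not_ge (le_trans ?_ hr)
  rw [← hcode c hc, ← hcode e he]
  refine dist_binaryPoint_le fun i j hj => ?_
  by_cases hij : i ∈ A j
  · have hji : (⟨j, i⟩ : Σ _ : ℕ, ι) ∈ (Finset.range k).sigma A :=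
      Finset.mem_sigma.2 ⟨Finset.mem_range.2 hj, hij⟩
    have hiff := Finset.ext_iff.1 hce ⟨j, i⟩
    simp only [ones, Finset.mem_filter, hji, true_and] at hiff
    omega
  · rw [hmem c hc i j hij, hmem e he i j hij]

end DigitSet

section Cascade

open Filter Topology

theorem isCompact_insert_iUnion {T : Type*} [TopologicalSpace T] {x : T} {K : ℕ → Set T}
    (hK : ∀ n, IsCompact (K n)) (hx : Tendsto K atTop (𝓝 x).smallSets) :
    IsCompact (insert x (⋃ n, K n)) := by
  refine isCompact_iff_ultrafilter_le_nhds.2 fun F hF => ?_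
  by_cases hFx : (F : Filter T) ≤ 𝓝 x
  · exact ⟨x, mem_insert _ _, hFx⟩
  obtain ⟨U, hU, hUF⟩ := Filter.not_le.1 hFx
  obtain ⟨N, hN⟩ := eventually_atTop.1 (tendsto_smallSets_iff.1 hx U hU)
  have hmem : ⋃ n ∈ Finset.range N, K n ∈ (F : Filter T) := by
    filter_upwards [le_principal_iff.1 hF, Ultrafilter.compl_mem_iff_notMem.2 hUF] with y hy hyU
    rcases hy with rfl | hy
    · exact absurd (mem_of_mem_nhds hU) hyU
    · obtain ⟨n, hn⟩ := mem_iUnion.1 hy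
      exact mem_biUnion (Finset.mem_range.2 (not_le.1 fun h => hyU (hN n h hn))) hn
  obtain ⟨y, hy, hFy⟩ := isCompact_iff_ultrafilter_le_nhds.1
    ((Finset.range N).isCompact_biUnion fun n _ => hK n) F (le_principal_iff.2 hmem)
  exact ⟨y, mem_insert_of_mem _ (iUnion₂_subset_iUnion _ _ hy), hFy⟩

variable {ι : Type*}

/-- The point with all coordinates equal to `3 * 2 ^ (-n)`. The factor `3` separates the cubes
`[3 * 2 ^ (-n), 4 * 2 ^ (-n)] ^ ι` for different `n`. -/
noncomputable def corner (ι : Type*) (n : ℕ) : EuclideanSpace ℝ ι :=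
  WithLp.toLp 2 fun _ => 3 * ((2 : ℝ) ^ n)⁻¹

/-- The digit sets with free digits `A n` at the corners converging to `0`, together with `0`. -/
def cascade (A : ℕ → ℕ → Finset ι) : Set (EuclideanSpace ℝ ι) :=
  insert 0 (⋃ n, digitSet (corner ι n) (A n))

variable {A : ℕ → ℕ → Finset ι} {x : EuclideanSpace ℝ ι} {n m k : ℕ}

theorem digitSet_subset_cascade : digitSet (corner ι n) (A n) ⊆ cascade A :=
  (subset_iUnion (fun n => digitSet (corner ι n) (A n)) n).trans (subset_insert _ _)

theorem inv_two_pow_anti (h : m ≤ n) : ((2 : ℝ) ^ n)⁻¹ ≤ ((2 : ℝ) ^ m)⁻¹ := by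
  gcongr
  exact one_le_two

theorem two_mul_inv_two_pow_le (h : m < n) : 2 * ((2 : ℝ) ^ n)⁻¹ ≤ ((2 : ℝ) ^ m)⁻¹ := by
  have hanti := inv_two_pow_anti (Nat.succ_le_of_lt h)
  rw [Nat.succ_eq_add_one, pow_succ, mul_inv] at hanti
  linarith

theorem apply_mem_Icc_of_mem_digitSet_corner (hA : ∀ n, ∀ j < n, A n j = ∅)
    (hx : x ∈ digitSet (corner ι n) (A n)) (i : ι) :
    x i ∈ Icc (3 * ((2 : ℝ) ^ n)⁻¹) (4 * ((2 : ℝ) ^ n)⁻¹) := by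
  have hi := apply_mem_Icc_of_mem_digitSet hx (hA n) i
  rw [corner] at hi
  exact ⟨hi.1, hi.2.trans_eq (by ring)⟩

variable [Fintype ι]

theorem dist_zero_le_of_mem_digitSet_corner (hA : ∀ n, ∀ j < n, A n j = ∅)
    (hx : x ∈ digitSet (corner ι n) (A n)) :
    dist x 0 ≤ 2 ^ Fintype.card ι * (4 * ((2 : ℝ) ^ n)⁻¹) := by
  refine dist_le_two_pow_mul (by positivity) fun i => ?_
  obtain ⟨hlow, hhigh⟩ := apply_mem_Icc_of_mem_digitSet_corner hA hx i
  rwa [PiLp.zero_apply, sub_zero, abs_of_nonneg (hlow.trans' (by positivity))]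

theorem isCompact_cascade {ι : Type*} [Finite ι] {A : ℕ → ℕ → Finset ι}
    (hA : ∀ n, ∀ j < n, A n j = ∅) : IsCompact (cascade A) := by
  have := Fintype.ofFinite ι
  refine isCompact_insert_iUnion (fun n => isCompact_digitSet _ _)
    (tendsto_smallSets_iff.2 fun U hU => ?_)
  obtain ⟨ε, hε, hεU⟩ := Metric.mem_nhds_iff.1 hU
  have hlim : Tendsto (fun n : ℕ => 2 ^ Fintype.card ι * (4 * ((2 : ℝ) ^ n)⁻¹)) atTop (𝓝 0) := by
    simpa using ((tendsto_inv_atTop_zero.comp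
      (tendsto_pow_atTop_atTop_of_one_lt one_lt_two)).const_mul (4 : ℝ)).const_mul
        ((2 : ℝ) ^ Fintype.card ι)
  filter_upwards [hlim.eventually_lt_const hε] with n hn
  exact fun x hx => hεU ((dist_zero_le_of_mem_digitSet_corner hA hx).trans_lt hn)

theorem mem_digitSet_of_mem_cascade (hA : ∀ n, ∀ j < n, A n j = ∅) (hx : x ∈ cascade A)
    (hxn : dist x (corner ι n) < ((2 : ℝ) ^ n)⁻¹) : x ∈ digitSet (corner ι n) (A n) := by
  rcases isEmpty_or_nonempty ι with hι | ⟨⟨i⟩⟩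
  · exact Subsingleton.elim (corner ι n) x ▸ self_mem_digitSet _ _
  have hpos : (0 : ℝ) < ((2 : ℝ) ^ n)⁻¹ := by positivity
  have hi : |x i - 3 * ((2 : ℝ) ^ n)⁻¹| < ((2 : ℝ) ^ n)⁻¹ :=
    (abs_sub_apply_le_dist x (corner ι n) i).trans_lt hxn
  rw [abs_lt] at hi
  rcases hx with rfl | hx
  · rw [PiLp.zero_apply] at hi
    linarith
  · obtain ⟨m, hm⟩ := mem_iUnion.1 hx
    have hmi := apply_mem_Icc_of_mem_digitSet_corner hA hm i
    rcases lt_trichotomy m n with hmn | rfl | hnm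
    · linarith [two_mul_inv_two_pow_le hmn, hmi.1]
    · exact hm
    · linarith [two_mul_inv_two_pow_le hnm, hmi.2]

theorem infPacking_cascade_le (hA : ∀ n, ∀ j < n, A n j = ∅) {r : ℝ≥0} {R : ℝ}
    (hr : 2 ^ Fintype.card ι * ((2 : ℝ) ^ k)⁻¹ ≤ r) (hR : R < ((2 : ℝ) ^ n)⁻¹) :
    infPacking (cascade A) r R ≤ (2 ^ ∑ j ∈ Finset.range k, (A n j).card : ℕ) :=
  (iInf₂_le _ (digitSet_subset_cascade (self_mem_digitSet (corner ι n) (A n)))).trans <|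
    (packingNumber_mono le_rfl fun _ hx =>
      mem_digitSet_of_mem_cascade hA hx.1 ((mem_closedBall.1 hx.2).trans_lt hR)).trans
        (packingNumber_digitSet_le hr)

/-- Points of the `n`-th piece with `m < n`, and `0`, are so close to `0` that the ball contains
the `m`-th piece. -/
theorem exists_two_pow_le_packingNumber_cascade (hA : ∀ n, ∀ j < n, A n j = ∅)
    (hx : x ∈ cascade A) {r : ℝ≥0} {R : ℝ} (hr : r < ((2 : ℝ) ^ k)⁻¹)
    (hR : 2 ^ Fintype.card ι * (4 * ((2 : ℝ) ^ m)⁻¹) ≤ R) :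
    ∃ n ≤ m, (2 ^ ∑ j ∈ Finset.Ico m k, (A n j).card : ℕ) ≤
      packingNumber r (cascade A ∩ closedBall x R) := by
  have hpos : (0 : ℝ) < ((2 : ℝ) ^ m)⁻¹ := by positivity
  suffices h : ∃ n ≤ m, ∃ y ∈ digitSet (corner ι n) (A n),
      dist y x ≤ 2 ^ Fintype.card ι * (3 * ((2 : ℝ) ^ m)⁻¹) by
    obtain ⟨n, hnm, y, hy, hyx⟩ := h
    exact ⟨n, hnm, (two_pow_le_packingNumber_digitSet hy hr le_rfl).trans <|
      packingNumber_mono le_rfl <| inter_subset_inter digitSet_subset_cascade <|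
        closedBall_subset_closedBall' (by linarith)⟩
  have hcorner (h : ∀ i, x i ∈ Icc 0 (4 * ((2 : ℝ) ^ m)⁻¹)) :
      dist (corner ι m) x ≤ 2 ^ Fintype.card ι * (3 * ((2 : ℝ) ^ m)⁻¹) := by
    refine dist_le_two_pow_mul (by positivity) fun i => ?_
    rw [corner, abs_le]
    constructor <;> linarith [(h i).1, (h i).2]
  rcases hx with rfl | hx
  · exact ⟨m, le_rfl, _, self_mem_digitSet _ _, hcorner fun i => ⟨le_rfl, by positivity⟩⟩
  obtain ⟨n, hn⟩ := mem_iUnion.1 hx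
  rcases le_total n m with hnm | hmn
  · exact ⟨n, hnm, x, hn, by rw [dist_self]; positivity⟩
  · refine ⟨m, le_rfl, _, self_mem_digitSet _ _, hcorner fun i => ?_⟩
    obtain ⟨hlow, hhigh⟩ := apply_mem_Icc_of_mem_digitSet_corner hA hn i
    exact ⟨hlow.trans' (by positivity), hhigh.trans (by linarith [inv_two_pow_anti hmn])⟩

end Cascade

section Realization

variable {d : ℕ} {f : ℝ → ℝ → ℝ} {n m k : ℕ} {u v : ℝ}

/-- The coordinates whose `j`-th digit is free in the `n`-th piece, chosen so that
`⌊f k n⌋₊` digits are free before the position `k`. -/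
noncomputable def freeCoords (d : ℕ) (f : ℝ → ℝ → ℝ) (n j : ℕ) : Finset (Fin d) :=
  if n ≤ j then Finset.univ.filter fun i => (i : ℕ) < ⌊f (j + 1 : ℕ) n⌋₊ - ⌊f j n⌋₊ else ∅

theorem freeCoords_of_lt (n j : ℕ) (h : j < n) : freeCoords d f n j = ∅ :=
  if_neg h.not_ge

theorem card_freeCoords (hf : MemL (d : ℝ≥0) f) {j : ℕ} (h : n ≤ j) :
    (freeCoords d f n j).card = ⌊f (j + 1 : ℕ) n⌋₊ - ⌊f j n⌋₊ := by
  have hnj : (n : ℝ) ≤ j := by exact_mod_cast h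
  have hstep : f (j + 1 : ℕ) n ≤ f j n + d := by
    simpa using hf.le_add (u := (j + 1 : ℕ)) hnj (by simp)
  have hfloor : ⌊f (j + 1 : ℕ) n⌋₊ ≤ ⌊f j n⌋₊ + d := by
    rw [← Nat.floor_add_natCast (hf.nonneg _ _ hnj)]
    exact Nat.floor_le_floor hstep
  rw [freeCoords, if_pos h]
  exact Fin.card_filter_val_lt.trans (min_eq_right (by omega))

theorem sum_range_card_freeCoords (hf : MemL (d : ℝ≥0) f) (h : n ≤ k) :
    ∑ j ∈ Finset.range k, (freeCoords d f n j).card = ⌊f k n⌋₊ := by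
  induction k, h using Nat.le_induction with
  | base =>
    rw [hf.diag, Nat.floor_zero]
    exact Finset.sum_eq_zero fun j hj => by
      rw [freeCoords_of_lt n j (Finset.mem_range.1 hj), Finset.card_empty]
  | succ k hk ih =>
    rw [Finset.sum_range_succ, ih, card_freeCoords hf hk]
    exact Nat.add_sub_cancel' <| Nat.floor_le_floor <|
      hf.mono (by exact_mod_cast hk) (by exact_mod_cast k.le_succ)

theorem floor_le_sum_Ico_card_freeCoords (hf : MemL (d : ℝ≥0) f) (hnm : n ≤ m) (hmk : m ≤ k) :
    ⌊f k m⌋₊ ≤ ∑ j ∈ Finset.Ico m k, (freeCoords d f n j).card := by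
  have hnm' : (n : ℝ) ≤ m := by exact_mod_cast hnm
  have hmk' : (m : ℝ) ≤ k := by exact_mod_cast hmk
  have hfloor : ⌊f k m⌋₊ + ⌊f m n⌋₊ ≤ ⌊f k n⌋₊ := Nat.le_floor <| by
    push_cast
    linarith [Nat.floor_le (hf.nonneg k m hmk'), Nat.floor_le (hf.nonneg m n hnm'),
      hf.superadd k m n hnm' hmk']
  have hsplit := Finset.sum_range_add_sum_Ico (fun j => (freeCoords d f n j).card) hmk
  rw [sum_range_card_freeCoords hf hnm, sum_range_card_freeCoords hf (hnm.trans hmk)] at hsplit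
  omega

theorem two_pow_mul_inv_two_pow (a k : ℕ) :
    (2 : ℝ) ^ a * ((2 : ℝ) ^ k)⁻¹ = (2 : ℝ) ^ ((a : ℝ) - k) := by
  rw [Real.rpow_sub two_pos, Real.rpow_natCast, Real.rpow_natCast, div_eq_mul_inv]

theorem inv_two_pow_eq_rpow (k : ℕ) : ((2 : ℝ) ^ k)⁻¹ = 2 ^ (-(k : ℝ)) := by
  rw [Real.rpow_neg two_pos.le, Real.rpow_natCast]

theorem four_mul_two_rpow_neg (u : ℝ) : 4 * (2 : ℝ) ^ (-u) = 2 ^ (2 - u) := by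
  rw [sub_eq_add_neg, Real.rpow_add two_pos]
  norm_num

theorem exists_nat_lt_and_le_add_one (hv : 0 < v) : ∃ n : ℕ, (n : ℝ) < v ∧ v ≤ n + 1 := by
  obtain ⟨n, hn⟩ := Nat.exists_eq_add_one.2 (Nat.ceil_pos.2 hv)
  exact ⟨n, Nat.lt_ceil.1 (by omega), by exact_mod_cast hn ▸ Nat.le_ceil v⟩

theorem packingGrowth_euclideanSpace (X : Set (EuclideanSpace ℝ (Fin d))) :
    PackingGrowth X d (2 * d) := by
  simpa using packingGrowth_of_finiteDimensional X

theorem cascade_nonempty {ι : Type*} (A : ℕ → ℕ → Finset ι) : (cascade A).Nonempty :=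
  ⟨0, mem_insert _ _⟩

theorem floor_le_branching_cascade (hf : MemL (d : ℝ≥0) f) (hvm : v + (d + 2) ≤ m)
    (hku : k + 2 < u) (hmk : m ≤ k) : ⌊f k m⌋₊ ≤ branching (cascade (freeCoords d f)) u v := by
  have hr : ((4 * 2 ^ (-u) : ℝ≥0) : ℝ) < ((2 : ℝ) ^ k)⁻¹ := by
    push_cast
    rw [four_mul_two_rpow_neg, inv_two_pow_eq_rpow]
    exact Real.rpow_lt_rpow_of_exponent_lt one_lt_two (by linarith)
  have hR : 2 ^ Fintype.card (Fin d) * (4 * ((2 : ℝ) ^ m)⁻¹) ≤ 2 ^ (-v) := by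
    rw [Fintype.card_fin, ← mul_assoc, show (2 : ℝ) ^ d * 4 = 2 ^ (d + 2) by ring,
      two_pow_mul_inv_two_pow]
    exact Real.rpow_le_rpow_of_exponent_le one_le_two (by push_cast; linarith)
  have hpacking : ((2 ^ ⌊f k m⌋₊ : ℕ) : ℕ∞) ≤
      infPacking (cascade (freeCoords d f)) (4 * 2 ^ (-u)) (2 ^ (-v)) := by
    refine le_iInf₂ fun x hx => ?_
    obtain ⟨n, hnm, hn⟩ := exists_two_pow_le_packingNumber_cascade freeCoords_of_lt hx hr hR
    refine le_trans ?_ hn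
    exact_mod_cast pow_le_pow_right₀ one_le_two (floor_le_sum_Ico_card_freeCoords hf hnm hmk)
  rw [← logTwo_two_pow]
  exact logTwo_le_logTwo hpacking ((packingGrowth_euclideanSpace _).infPacking_ne_top
    (cascade_nonempty _) (by positivity) _)

theorem branching_cascade_le_floor (hf : MemL (d : ℝ≥0) f) (hnv : n < v) (huk : u + d ≤ k)
    (hnk : n ≤ k) : branching (cascade (freeCoords d f)) u v ≤ ⌊f k n⌋₊ := by
  have hr : 2 ^ Fintype.card (Fin d) * ((2 : ℝ) ^ k)⁻¹ ≤ (4 * 2 ^ (-u) : ℝ≥0) := by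
    push_cast
    rw [Fintype.card_fin, four_mul_two_rpow_neg, two_pow_mul_inv_two_pow]
    exact Real.rpow_le_rpow_of_exponent_le one_le_two (by linarith)
  have hR : (2 : ℝ) ^ (-v) < ((2 : ℝ) ^ n)⁻¹ := by
    rw [inv_two_pow_eq_rpow]
    exact Real.rpow_lt_rpow_of_exponent_lt one_lt_two (neg_lt_neg hnv)
  rw [← logTwo_two_pow, ← sum_range_card_freeCoords hf hnk]
  exact logTwo_le_logTwo (infPacking_cascade_le freeCoords_of_lt hr hR) (ENat.natCast_ne_top _)

theorem sub_le_branching_cascade (hf : MemL (d : ℝ≥0) f) (hv : 0 ≤ v) (hvu : v + (d + 6) ≤ u) :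
    f u (v + (d + 3)) - (3 * d + 1) ≤ branching (cascade (freeCoords d f)) u v := by
  obtain ⟨m, hvm, hmv⟩ : ∃ m : ℕ, v + (d + 2) ≤ m ∧ m ≤ v + (d + 3) := by
    refine ⟨⌈v⌉₊ + (d + 2), ?_, ?_⟩ <;> push_cast <;>
      linarith [Nat.le_ceil v, Nat.ceil_lt_add_one hv]
  have hd : (0 : ℝ) ≤ d := d.cast_nonneg
  obtain ⟨k, hku, huk⟩ := exists_nat_lt_and_le_add_one (show 0 < u - 2 by linarith [hd])
  have hmk : (m : ℝ) ≤ k := by linarith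
  have hlip := hf.le_add hmk (show (k : ℝ) ≤ u by linarith)
  have hslack : (d : ℝ) * (u - k) ≤ d * 3 := by
    gcongr
    linarith
  rw [NNReal.coe_natCast] at hlip
  linarith [floor_le_branching_cascade hf hvm (lt_sub_iff_add_lt.1 hku) (by exact_mod_cast hmk),
    Nat.lt_floor_add_one (f k m), hf.anti hmv (show v + (d + 3) ≤ u by linarith)]

theorem branching_cascade_le (hf : MemL (d : ℝ≥0) f) (hv : 0 < v) (hvu : v ≤ u) :
    branching (cascade (freeCoords d f)) u v ≤ f u (v - 1) + d * (d + 1) := by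
  obtain ⟨n, hnv, hvn⟩ := exists_nat_lt_and_le_add_one hv
  obtain ⟨k, huk, hku⟩ : ∃ k : ℕ, u + d ≤ k ∧ k ≤ u + (d + 1) := by
    refine ⟨⌈u⌉₊ + d, ?_, ?_⟩ <;> push_cast <;>
      linarith [Nat.le_ceil u, Nat.ceil_lt_add_one (hv.le.trans hvu)]
  have hd : (0 : ℝ) ≤ d := d.cast_nonneg
  have hnu : (n : ℝ) ≤ u := by linarith
  have hnk : (n : ℝ) ≤ k := by linarith [hd]
  have hlip := hf.le_add hnu (show u ≤ k by linarith [hd])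
  have hslack : (d : ℝ) * (k - u) ≤ d * (d + 1) := by
    gcongr
    linarith
  rw [NNReal.coe_natCast] at hlip
  linarith [branching_cascade_le_floor hf hnv huk (by exact_mod_cast hnk),
    Nat.floor_le (hf.nonneg k n hnk), hf.anti (show v - 1 ≤ n by linarith) hnu]

theorem simWith_cascade (hf : MemL (d : ℝ≥0) f) :
    SimWith ((d + 3) ^ 2) (fun u v => (f u v : EReal))
      (lowerBranching (cascade (freeCoords d f))) := by
  have hd : (0 : ℝ) ≤ d := d.cast_nonneg
  have hd2 : (0 : ℝ) ≤ d * d := mul_nonneg hd hd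
  rw [show ((d : ℝ) + 3) ^ 2 = d * d + 6 * d + 9 by ring]
  refine (packingGrowth_euclideanSpace _).simWith_lowerBranching (cascade_nonempty _) hf.nonneg
    (fun u v hv hvu => ?_) fun u v hzv hvu => ?_
  · linarith [sub_le_branching_cascade hf hv (show v + (d + 6) ≤ u by linarith),
      hf.anti (show v + (d + 3) ≤ v + (d * d + 6 * d + 9) by linarith) hvu]
  · linarith [branching_cascade_le hf (show 0 < v by linarith) hvu,
      hf.anti (show v - (d * d + 6 * d + 9) ≤ v - 1 by linarith) (show v - 1 ≤ u by linarith)]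

end Realization

theorem theoremB (d : ℕ) :
    (∃ z : ℝ, 0 ≤ z ∧
      ∀ X : Set (EuclideanSpace ℝ (Fin d)), X.Nonempty →
        ∃ f : ℝ → ℝ → ℝ, MemL (d : ℝ≥0) f ∧
          SimWith z (fun u v => (f u v : EReal)) (lowerBranching X)) ∧
    (∃ z : ℝ, 0 ≤ z ∧
      ∀ f : ℝ → ℝ → ℝ, MemL (d : ℝ≥0) f →
        ∃ X : Set (EuclideanSpace ℝ (Fin d)), X.Nonempty ∧ IsCompact X ∧
          SimWith z (fun u v => (f u v : EReal)) (lowerBranching X)) := by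
  refine ⟨⟨d + 2 * d + 1, by positivity, fun X hX => ?_⟩, ⟨(d + 3) ^ 2, by positivity, fun f hf =>
    ⟨cascade (freeCoords d f), cascade_nonempty _, isCompact_cascade freeCoords_of_lt,
      simWith_cascade hf⟩⟩⟩
  simpa using (packingGrowth_euclideanSpace X).exists_memL_simWith hX
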